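/- Let $\mathbb K$ be $\mathbb R$ or $\mathbb C$ and let $\mathcal C=\bigoplus_{a,b\in\mathbb Z}\mathcal C_{a,b}$ be an $s$-multicomplex ($s<\infty$) of $\mathbb K$-vector spaces: there are linear maps $d_i\colon\mathcal C\to\mathcal C$, $i\ge 0$, of bidegree $(i,1-i)$ with $\sum_{i+j=n}d_id_j=0$ for all $n\ge 0$ and $d_i=0$ for $i\ge s$. An element of $\mathcal C_{p,k-p}$ has weight $p$ and degree $k$. Assume that $\mathcal C_{a,b}\neq0$ for only finitely many weights $a$, so that the total complex is $(\mathrm{Tot}\,\mathcal C)_k=\bigoplus_p\mathcal C_{p,k-p}$ with $d=d_0+d_1+\cdots+d_s$. Let $\mathcal C$ carry a scalar product for which elements of equal degree and different weights are orthogonal. For $r\ge 1$ let $Z_r^{p,k-p}$ be the set of $\alpha\in\mathcal C_{p,k-p}$ with $d_0\alpha=0$ for which there are $z_{p+i}\in\mathcal C_{p+i,k-p-i}$ $(1\le i\le r-1)$ with $d_n\alpha=\sum_{i=0}^{n-1}d_iz_{p+n-i}$ for $1\le n\le r-1$; let $B_r^{p,k-p}$ be the set of all $\alpha=\sum_{i=0}^{r-1}d_ic_{p-i}$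 with $c_{p-i}\in\mathcal C_{p-i,k-1-p+i}$ $(0\le i\le r-1)$ and $\sum_{i=n}^{r-1}d_{i-n}c_{p-i}=0$ for $1\le n\le r-1$. Put $Z_\infty=\bigcap_{r\ge1}Z_r$, $B_\infty=\bigcup_{r\ge1}B_r$ and $E_\infty^{p,k-p}=Z_\infty^{p,k-p}/B_\infty^{p,k-p}$. Assume that each $B_r^{p,k-p}$ has an orthogonal complement in $\mathcal C$, that is $\mathcal C=B_r^{p,k-p}\oplus(B_r^{p,k-p})^\perp$ (for instance, $\mathcal C_{p,k-p}$ is orthogonal to the other bidegrees and complete, and $B_r^{p,k-p}$ is closed). For $j,l\ge1$ put $$E_{j,l}^{p,k-p}=Z_j^{p,k-p}\cap\bigl(B_l^{p,k-p}\bigr)^\perp ,$$ and for $m\ge1$ let $\Delta_j\colon E_{j,l}^{p,k-p}\to E_{m,j}^{p+j,k+1-p-j}$ send $\alpha$ to the orthogonal projection of $d_j\alpha-\sum_{i=1}^{j-1}d_{j-i}z_{p+i}$ onto $(B_j^{p+j,k+1-p-j})^\perp$, where the $z_{p+i}$ are as in the definition of $\alpha\in Z_j^{p,k-p}$ (this projection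 does not depend on their choice). Let $I_{p,k}$ be the set of those $j\ge1$ for which $\Delta_j\colon E_{j,j}^{p,k-p}\to E_{j,j}^{p+j,k+1-p-j}$ (the $j$-th page differential $Z_j/B_j\to Z_j/B_j$) is nonzero. 1. For all $p,k\in\mathbb Z$ and all $j,l,m_1,m_2\ge1$, the sequence $$E_{l,m_1}^{p-l,k-1-p+l}\xrightarrow{\Delta_l}E_{j,l}^{p,k-p}\xrightarrow{\Delta_j}E_{m_2,j}^{p+j,k+1-p-j}$$ satisfies $\Delta_j\circ\Delta_l=0$, one has $B_{l+1}^{p,k-p}\subseteq Z_{j+1}^{p,k-p}$ and $\ker\Delta_j\subseteq Z_{j+1}^{p,k-p}$, and $[\alpha]\mapsto[\alpha]$ is an isomorphism $$\frac{\ker\Delta_j}{\mathrm{Im}\,\Delta_l}\cong\frac{Z_{j+1}^{p,k-p}}{B_{l+1}^{p,k-p}} .$$ 2. For every $(p,k)$ there is a pair $(J,L)$ of integers $\ge1$ with $Z_{J+1}^{p,k-p}=Z_\infty^{p,k-p}$ and $B_{L+1}^{p,k-p}=B_\infty^{p,k-p}$. Moreover one can choose $J\in I_{p,k}$ unless $I_{p,k}=\emptyset$,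 and $L$ with $L\in I_{p-L,k-1}$ unless $l\notin I_{p-l,k-1}$ for all $l$. 3. Let $k\in\mathbb Z$, for every $p$ let $(J_p,L_p)$ be any pair of integers $\ge 1$ with $Z_{J_p+1}^{p,k-p}=Z_\infty^{p,k-p}$ and $B_{L_p+1}^{p,k-p}=B_\infty^{p,k-p}$, and let $m_1,m_2\ge1$ (possibly depending on $p$). Then $$\bigoplus_p\frac{\ker\bigl(\Delta_{J_p}\colon E_{J_p,L_p}^{p,k-p}\to E_{m_2,J_p}^{p+J_p,k+1-p-J_p}\bigr)}{\mathrm{Im}\bigl(\Delta_{L_p}\colon E_{L_p,m_1}^{p-L_p,k-1-p+L_p}\to E_{J_p,L_p}^{p,k-p}\bigr)}\cong\bigoplus_pE_\infty^{p,k-p}\cong H^k(\mathrm{Tot}\,\mathcal C,d).$$ Here the first isomorphism is $[\alpha]\mapsto[\alpha]$ in every weight $p$ (in particular $\ker\Delta_{J_p}\subseteq Z_\infty^{p,k-p}$), and the second can be chosen linear and such that, for every $p$ and every $\alpha\in Z_\infty^{p,k-p}$, the class $[\alpha]\in E_\infty^{p,k-p}$ is sent to the class of some $d$-cocycle $x\in(\mathrm{Tot}\,\mathcal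 C)_k$ for which $x-\alpha$ has only components of weight $>p$. So the collection of spectral complexes recovers the cohomology of the multicomplex. -/

import Mathlib

open scoped DirectSum

/-- An `s`-multicomplex over `R`: a `(ℤ, ℤ)`-graded `R`-module `V = ⨁ C a b` with maps `d i` of
bidegree `(i, 1 - i)` such that `∑_{i+j=n} d i ∘ d j = 0` for all `n` and `d i = 0` for `i ≥ s`.
For `x ∈ C a b` the weight of `x` is `a` and its degree is `a + b`. -/
structure Multicomplex (R V : Type*) [CommRing R] [AddCommGroup V] [Module R V] (s : ℕ) where
  C : ℤ → ℤ → Submodule R V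
  isInternal : DirectSum.IsInternal (fun ab : ℤ × ℤ => C ab.1 ab.2)
  d : ℕ → V →ₗ[R] V
  d_mem : ∀ (i : ℕ) (a b : ℤ) (x : V), x ∈ C a b → d i x ∈ C (a + i) (b + 1 - i)
  d_comp : ∀ n : ℕ, ∑ ij ∈ Finset.HasAntidiagonal.antidiagonal n, d ij.1 ∘ₗ d ij.2 = 0
  d_eq_zero : ∀ i : ℕ, s ≤ i → d i = 0

namespace Multicomplex

section Algebra

variable {R V : Type*} [CommRing R] [AddCommGroup V] [Module R V] {s : ℕ}
  (M : Multicomplex R V s)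

/-- The elements of weight `p` and degree `k`, that is, the module `C_{p,k-p}`. -/
def piece (p k : ℤ) : Submodule R V := M.C p (k - p)

/-- Only finitely many weights occur. -/
def FiniteWeights : Prop := {a : ℤ | ∃ b : ℤ, M.C a b ≠ ⊥}.Finite

/-- The degree `k` part of the total complex. When only finitely many weights occur, the
products and the direct sums in the general definition agree with this direct sum. -/
def Tot (k : ℤ) : Submodule R V := ⨆ a : ℤ, M.piece a k

/-- The elements of degree `k` all of whose components have weight at least `p`. -/
def weightFiltration (p k : ℤ) : Submodule R V := ⨆ (a : ℤ) (_ : p ≤ a), M.piece a k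

/-- The differential `d = d₀ + d₁ + ⋯ + d_s` of the total complex. -/
def totalD : V →ₗ[R] V := ∑ i ∈ Finset.range (s + 1), M.d i

/-- The `d`-cocycles of degree `k`. -/
def cocycles (k : ℤ) : Submodule R V := LinearMap.ker M.totalD ⊓ M.Tot k

/-- The `d`-coboundaries of degree `k`. -/
def coboundaries (k : ℤ) : Submodule R V := (M.Tot (k - 1)).map M.totalD

/-- `H^k(Tot C, d)`. -/
abbrev TotalCohomology (k : ℤ) : Type _ :=
  M.cocycles k ⧸ (M.coboundaries k).submoduleOf (M.cocycles k)

/-- `z i`, for `1 ≤ i ≤ r - 1`, are elements `z_{p+i}` that witness `α ∈ Z_r^{p,k-p}`. -/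
def IsWitness (r : ℕ) (p k : ℤ) (α : V) (z : ℕ → V) : Prop :=
  (∀ i : ℕ, 1 ≤ i → i < r → z i ∈ M.piece (p + i) k) ∧
  M.d 0 α = 0 ∧
  ∀ n : ℕ, 1 ≤ n → n < r → M.d n α = ∑ i ∈ Finset.range n, M.d i (z (n - i))

variable {M} in
theorem IsWitness.add {r : ℕ} {p k : ℤ} {α β : V} {z w : ℕ → V} (h : M.IsWitness r p k α z)
    (h' : M.IsWitness r p k β w) : M.IsWitness r p k (α + β) (z + w) := by
  refine ⟨fun i hi hr => add_mem (h.1 i hi hr) (h'.1 i hi hr), by simp [h.2.1, h'.2.1], ?_⟩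
  intro n hn hr
  simp [h.2.2 n hn hr, h'.2.2 n hn hr, Finset.sum_add_distrib]

variable {M} in
theorem IsWitness.smul {r : ℕ} {p k : ℤ} {α : V} {z : ℕ → V} (c : R)
    (h : M.IsWitness r p k α z) : M.IsWitness r p k (c • α) (c • z) := by
  refine ⟨fun i hi hr => Submodule.smul_mem _ c (h.1 i hi hr), by simp [h.2.1], ?_⟩
  intro n hn hr
  simp [h.2.2 n hn hr, Finset.smul_sum]

/-- The module `Z_r^{p,k-p}` (for `r ≥ 1`). -/
def Z (r : ℕ) (p k : ℤ) : Submodule R V where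
  carrier := {α | α ∈ M.piece p k ∧ ∃ z, M.IsWitness r p k α z}
  zero_mem' := ⟨zero_mem _, 0, fun i _ _ => zero_mem _, by simp, by simp⟩
  add_mem' := by
    rintro a b ⟨ha, z, hz⟩ ⟨hb, w, hw⟩
    exact ⟨add_mem ha hb, _, hz.add hw⟩
  smul_mem' := by
    rintro c a ⟨ha, z, hz⟩
    exact ⟨Submodule.smul_mem _ c ha, _, hz.smul c⟩

/-- The module `B_r^{p,k-p}` (for `r ≥ 1`); here `c i` is the element `c_{p-i}`. -/
def B (r : ℕ) (p k : ℤ) : Submodule R V where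
  carrier := {α | ∃ c : ℕ → V, (∀ i : ℕ, i < r → c i ∈ M.piece (p - i) (k - 1)) ∧
    α = ∑ i ∈ Finset.range r, M.d i (c i) ∧
    ∀ l : ℕ, 1 ≤ l → l < r → 0 = ∑ i ∈ Finset.Ico l r, M.d (i - l) (c i)}
  zero_mem' := ⟨0, fun i _ => zero_mem _, by simp, by simp⟩
  add_mem' := by
    rintro a b ⟨c, hc, rfl, hc'⟩ ⟨e, he, rfl, he'⟩
    refine ⟨c + e, fun i hi => add_mem (hc i hi) (he i hi), ?_, ?_⟩
    · simp [Finset.sum_add_distrib]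
    · intro l hl hr
      simp [Finset.sum_add_distrib, ← hc' l hl hr, ← he' l hl hr]
  smul_mem' := by
    rintro t a ⟨c, hc, rfl, hc'⟩
    refine ⟨t • c, fun i hi => Submodule.smul_mem _ t (hc i hi), ?_, ?_⟩
    · simp [Finset.smul_sum]
    · intro l hl hr
      simp [← Finset.smul_sum, ← hc' l hl hr]

/-- `Z_∞^{p,k-p} = ⋂_{r ≥ 1} Z_r^{p,k-p}`. -/
def ZInf (p k : ℤ) : Submodule R V := ⨅ (r : ℕ) (_ : 1 ≤ r), M.Z r p k

/-- `B_∞^{p,k-p}`, the union of the increasing sequence `B_r^{p,k-p}`, `r ≥ 1`. -/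
def BInf (p k : ℤ) : Submodule R V := ⨆ (r : ℕ) (_ : 1 ≤ r), M.B r p k

/-- The limit term `E_∞^{p,k-p} = Z_∞^{p,k-p} / B_∞^{p,k-p}` of the spectral sequence. -/
abbrev EInf (p k : ℤ) : Type _ := M.ZInf p k ⧸ (M.BInf p k).submoduleOf (M.ZInf p k)

/-- The element `d_j α - ∑_{i=1}^{j-1} d_{j-i} z_{p+i}` that represents `Δ_j [α]`. -/
def rawDelta (j : ℕ) (α : V) (z : ℕ → V) : V :=
  M.d j α - ∑ i ∈ Finset.Ico 1 j, M.d (j - i) (z i)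

theorem d_mem_piece (i : ℕ) {p k : ℤ} {x : V} (hx : x ∈ M.piece p k) :
    M.d i x ∈ M.piece (p + i) (k + 1) := by
  have := M.d_mem i _ _ x hx
  unfold piece
  convert this using 2
  ring

theorem sum_d_d (n : ℕ) (x : V) :
    ∑ ij ∈ Finset.HasAntidiagonal.antidiagonal n, M.d ij.1 (M.d ij.2 x) = 0 := by
  simpa using LinearMap.congr_fun (M.d_comp n) x

theorem sum_d_sum_d (u : ℕ → V) (N : ℕ) :
    ∑ x ∈ Finset.HasAntidiagonal.antidiagonal N,
      M.d x.1 (∑ y ∈ Finset.HasAntidiagonal.antidiagonal x.2, M.d y.1 (u y.2)) = 0 := by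
  have h : ∑ x ∈ Finset.HasAntidiagonal.antidiagonal N,
      ∑ y ∈ Finset.HasAntidiagonal.antidiagonal x.1, M.d y.1 (M.d y.2 (u x.2)) = 0 :=
    Finset.sum_eq_zero fun x _ => M.sum_d_d _ _
  rw [← h]
  simp only [map_sum]
  rw [Finset.sum_sigma', Finset.sum_sigma']
  refine Finset.sum_nbij' (fun x => ⟨(x.1.1 + x.2.1, x.2.2), (x.1.1, x.2.1)⟩)
    (fun x => ⟨(x.2.1, x.2.2 + x.1.2), (x.2.2, x.1.2)⟩) ?_ ?_ ?_ ?_ ?_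
  all_goals rintro ⟨⟨a, b⟩, ⟨c, e⟩⟩ hx
  all_goals simp only [Finset.mem_sigma, Finset.HasAntidiagonal.mem_antidiagonal] at hx ⊢
  · exact ⟨by omega, trivial⟩
  · exact ⟨by omega, trivial⟩
  · obtain ⟨-, rfl⟩ := hx
    rfl
  · obtain ⟨-, rfl⟩ := hx
    rfl

theorem mem_Z_of_leading {q k : ℤ} (u : ℕ → V) (hu : ∀ i : ℕ, u i ∈ M.piece (q + i) k) (t : ℕ)
    (h0 : ∀ n, n < t → ∑ y ∈ Finset.HasAntidiagonal.antidiagonal n, M.d y.1 (u y.2) = 0) (m : ℕ) :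
    ∑ y ∈ Finset.HasAntidiagonal.antidiagonal t, M.d y.1 (u y.2) ∈ M.Z m (q + t) (k + 1) := by
  let D : ℕ → V := fun n => ∑ y ∈ Finset.HasAntidiagonal.antidiagonal n, M.d y.1 (u y.2)
  have hDmem : ∀ n : ℕ, D n ∈ M.piece (q + n) (k + 1) := by
    intro n
    refine Submodule.sum_mem _ fun y hy => ?_
    have h1 := M.d_mem_piece y.1 (hu y.2)
    have h2 : (q + n : ℤ) = q + y.2 + y.1 := by
      have := Finset.HasAntidiagonal.mem_antidiagonal.1 hy
      push_cast [← this]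
      ring
    rwa [h2]
  have key : ∀ n : ℕ, ∑ i ∈ Finset.range (n + 1), M.d i (D (t + (n - i))) = 0 := by
    intro n
    have h := M.sum_d_sum_d u (t + n)
    change ∑ x ∈ Finset.HasAntidiagonal.antidiagonal (t + n), M.d x.1 (D x.2) = 0 at h
    rw [Finset.Nat.sum_antidiagonal_eq_sum_range_succ_mk] at h
    rw [← h]
    have hsub : Finset.range (n + 1) ⊆ Finset.range (t + n).succ := by
      intro i hi
      simp only [Finset.mem_range] at hi ⊢
      omega
    rw [← Finset.sum_subset hsub]
    · refine Finset.sum_congr rfl fun i hi => ?_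
      simp only [Finset.mem_range] at hi
      have : t + (n - i) = t + n - i := by omega
      rw [this]
    · intro i hi hi'
      simp only [Finset.mem_range] at hi hi'
      have : D (t + n - i) = 0 := h0 _ (by omega)
      simp [this]
  refine ⟨hDmem t, fun i => -D (t + i), ?_, ?_, ?_⟩
  · intro i _ _
    have := hDmem (t + i)
    push_cast at this
    rw [← add_assoc] at this
    exact neg_mem this
  · have h := key 0
    rw [Finset.sum_range_one] at h
    exact h
  · intro n hn _
    have h := key n
    rw [Finset.sum_range_succ] at h
    simp only [map_neg, Finset.sum_neg_distrib]
    have h' := eq_neg_of_add_eq_zero_right h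
    rw [Nat.sub_self, Nat.add_zero] at h'
    exact h'

theorem B_le_Z (r m : ℕ) (p k : ℤ) : M.B r p k ≤ M.Z m p k := by
  rintro α ⟨c, hc, rfl, hc'⟩
  rcases Nat.eq_zero_or_pos r with rfl | hr
  · simp
  let u : ℕ → V := fun i => if i < r then c (r - 1 - i) else 0
  have hu : ∀ i : ℕ, u i ∈ M.piece ((p - (r - 1 : ℕ)) + i) (k - 1) := by
    intro i
    by_cases hi : i < r
    · have h1 := hc (r - 1 - i) (by omega)
      have h2 : (p - (r - 1 : ℕ) + i : ℤ) = p - ((r - 1 - i : ℕ) : ℤ) := by omega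
      simpa [u, hi, h2] using h1
    · simp [u, hi]
  have hsum : ∀ l, l < r → ∑ y ∈ Finset.HasAntidiagonal.antidiagonal (r - 1 - l), M.d y.1 (u y.2) =
      ∑ i ∈ Finset.Ico l r, M.d (i - l) (c i) := by
    intro l hl
    rw [Finset.Nat.sum_antidiagonal_eq_sum_range_succ_mk, Finset.sum_Ico_eq_sum_range]
    have : (r - 1 - l).succ = r - l := by omega
    rw [this]
    refine Finset.sum_congr rfl fun i hi => ?_
    simp only [Finset.mem_range] at hi
    have h1 : r - 1 - l - i < r := by omega
    have h2 : r - 1 - (r - 1 - l - i) = l + i := by omega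
    simp [u, h1, h2]
  have h := M.mem_Z_of_leading u hu (r - 1) (fun n hn => by
    have h1 := hsum (r - 1 - n) (by omega)
    have h2 : r - 1 - (r - 1 - n) = n := by omega
    rw [h2] at h1
    rw [h1]
    exact (hc' _ (by omega) (by omega)).symm) m
  have h0 := hsum 0 hr
  simp only [Nat.sub_zero, Nat.Ico_zero_eq_range] at h0
  rw [h0] at h
  simpa using h

theorem rawDelta_mem_Z {j : ℕ} (hj : 1 ≤ j) {p k : ℤ} {α : V} {z : ℕ → V} (hα : α ∈ M.piece p k)
    (h : M.IsWitness j p k α z) (m : ℕ) : M.rawDelta j α z ∈ M.Z m (p + j) (k + 1) := by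
  let u : ℕ → V := fun i => if i = 0 then α else if i < j then -z i else 0
  have hu : ∀ i : ℕ, u i ∈ M.piece (p + i) k := by
    intro i
    rcases Nat.eq_zero_or_pos i with rfl | hi
    · simpa [u] using hα
    by_cases hij : i < j
    · simpa [u, hi.ne', hij] using h.1 i hi hij
    · simp [u, hi.ne', hij]
  have hsum : ∀ n : ℕ, 1 ≤ n → n < j → ∑ y ∈ Finset.HasAntidiagonal.antidiagonal n, M.d y.1 (u y.2) = 0 := by
    intro n hn hnj
    rw [Finset.Nat.sum_antidiagonal_eq_sum_range_succ_mk, Finset.sum_range_succ]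
    have h1 : ∑ i ∈ Finset.range n, M.d i (u (n - i)) =
        -∑ i ∈ Finset.range n, M.d i (z (n - i)) := by
      rw [← Finset.sum_neg_distrib]
      refine Finset.sum_congr rfl fun i hi => ?_
      simp only [Finset.mem_range] at hi
      have h2 : n - i ≠ 0 := by omega
      have h3 : n - i < j := by omega
      simp [u, h2, h3]
    simp only [h1]
    simp [u, h.2.2 n hn hnj]
  have hraw : ∑ y ∈ Finset.HasAntidiagonal.antidiagonal j, M.d y.1 (u y.2) = M.rawDelta j α z := by
    rw [← Finset.Nat.sum_antidiagonal_swap]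
    simp only [Prod.fst_swap, Prod.snd_swap]
    rw [Finset.Nat.sum_antidiagonal_eq_sum_range_succ_mk, Finset.sum_range_succ,
      ← Nat.Ico_zero_eq_range, Finset.sum_eq_sum_Ico_succ_bot (by omega)]
    have h1 : ∑ i ∈ Finset.Ico (0 + 1) j, M.d (j - i) (u i) =
        -∑ i ∈ Finset.Ico 1 j, M.d (j - i) (z i) := by
      rw [← Finset.sum_neg_distrib]
      refine Finset.sum_congr (by simp) fun i hi => ?_
      simp only [Finset.mem_Ico] at hi
      have h2 : i ≠ 0 := by omega
      simp [u, h2, hi.2]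
    simp only [h1]
    have h3 : j ≠ 0 := by omega
    simp [u, rawDelta, h3, sub_eq_add_neg]
  rw [← hraw]
  refine M.mem_Z_of_leading u hu j (fun n hn => ?_) m
  rcases Nat.eq_zero_or_pos n with rfl | hn'
  · simp [u, h.2.1]
  · exact hsum n hn' hn

theorem rawDelta_zero_mem_B {j : ℕ} {p k : ℤ} {z : ℕ → V} (h : M.IsWitness j p k 0 z) :
    M.rawDelta j 0 z ∈ M.B j (p + j) (k + 1) := by
  refine ⟨fun i => if i = 0 then 0 else -z (j - i), ?_, ?_, ?_⟩
  · intro i hi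
    by_cases h0 : i = 0
    · simp [h0]
    · have h1 := h.1 (j - i) (by omega) (by omega)
      have h2 : (p + j - i : ℤ) = p + ((j - i : ℕ) : ℤ) := by omega
      simpa [h0, h2] using h1
  · rcases Nat.eq_zero_or_pos j with rfl | hj
    · simp [rawDelta]
    rw [← Nat.Ico_zero_eq_range, Finset.sum_eq_sum_Ico_succ_bot hj]
    simp only [rawDelta, map_zero, zero_sub, if_true, zero_add]
    rw [← Finset.sum_neg_distrib]
    refine Finset.sum_bij' (fun i _ => j - i) (fun i _ => j - i) ?_ ?_ ?_ ?_ ?_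
    all_goals intro i hi; simp only [Finset.mem_Ico] at hi ⊢
    · omega
    · omega
    · omega
    · omega
    · have h1 : j - i ≠ 0 := by omega
      have h2 : j - (j - i) = i := by omega
      simp [h1, h2]
  · intro l hl hlj
    have h1 := h.2.2 (j - l) (by omega) (by omega)
    rw [map_zero] at h1
    rw [Finset.sum_Ico_eq_sum_range, ← neg_zero, h1, ← Finset.sum_neg_distrib]
    refine Finset.sum_congr rfl fun i hi => ?_
    have h2 : l + i ≠ 0 := by omega
    have h3 : j - l - i = j - (l + i) := by omega
    have h4 : l + i - l = i := by omega
    simp only [h2, if_false, h3, h4, map_neg]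

theorem rawDelta_add (j : ℕ) (α β : V) (z w : ℕ → V) :
    M.rawDelta j (α + β) (z + w) = M.rawDelta j α z + M.rawDelta j β w := by
  simp [rawDelta, Finset.sum_add_distrib]
  abel

theorem rawDelta_smul (j : ℕ) (c : R) (α : V) (z : ℕ → V) :
    M.rawDelta j (c • α) (c • z) = c • M.rawDelta j α z := by
  simp [rawDelta, ← Finset.smul_sum, smul_sub]

/-- Two choices of the elements `z_{p+i}` change the representative by an element of `B_j`. -/
theorem rawDelta_sub_mem_B {j : ℕ} {p k : ℤ} {α : V} {z w : ℕ → V} (hz : M.IsWitness j p k α z)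
    (hw : M.IsWitness j p k α w) :
    M.rawDelta j α z - M.rawDelta j α w ∈ M.B j (p + j) (k + 1) := by
  have h := hz.add (hw.smul (-1 : R))
  have h' : α + (-1 : R) • α = 0 := by simp
  have e : M.rawDelta j α z - M.rawDelta j α w =
      M.rawDelta j (α + (-1 : R) • α) (z + (-1 : R) • w) := by
    rw [rawDelta_add, rawDelta_smul]
    simp [sub_eq_add_neg]
  rw [e, h']
  rw [h'] at h
  exact M.rawDelta_zero_mem_B h

end Algebra

section Spectral

variable {𝕜 V : Type*} [RCLike 𝕜] [NormedAddCommGroup V] [InnerProductSpace 𝕜 V] {s : ℕ}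
  (M : Multicomplex 𝕜 V s)

/-- Elements of the same degree and of different weights are orthogonal. -/
def WeightsOrthogonal : Prop :=
  ∀ (k a₁ a₂ : ℤ) (x₁ x₂ : V), a₁ ≠ a₂ → x₁ ∈ M.piece a₁ k → x₂ ∈ M.piece a₂ k →
    inner 𝕜 x₁ x₂ = 0

/-- The space `E_{j,l}^{p,k-p} = Z_j^{p,k-p} ∩ (B_l^{p,k-p})^⊥`. -/
def E (j l : ℕ) (p k : ℤ) : Submodule 𝕜 V := M.Z j p k ⊓ (M.B l p k)ᗮ

variable [∀ (r : ℕ) (p k : ℤ), (M.B r p k).HasOrthogonalProjection]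

theorem proj_rawDelta_mem {j : ℕ} (hj : 1 ≤ j) (m : ℕ) {p k : ℤ} {α : V} {z : ℕ → V}
    (hα : α ∈ M.piece p k) (h : M.IsWitness j p k α z) :
    (M.B j (p + j) (k + 1))ᗮ.starProjection (M.rawDelta j α z) ∈ M.E m j (p + j) (k + 1) := by
  refine ⟨?_, Submodule.starProjection_apply_mem _ _⟩
  rw [Submodule.starProjection_orthogonal_val]
  exact sub_mem (M.rawDelta_mem_Z hj hα h m)
    (M.B_le_Z j m _ _ (Submodule.starProjection_apply_mem _ _))

theorem proj_rawDelta_eq {j : ℕ} {p k : ℤ} {α : V} {z w : ℕ → V}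
    (hz : M.IsWitness j p k α z) (hw : M.IsWitness j p k α w) :
    (M.B j (p + j) (k + 1))ᗮ.starProjection (M.rawDelta j α z) =
      (M.B j (p + j) (k + 1))ᗮ.starProjection (M.rawDelta j α w) := by
  rw [← sub_eq_zero, ← map_sub, Submodule.starProjection_apply_eq_zero_iff,
    Submodule.orthogonal_orthogonal]
  exact M.rawDelta_sub_mem_B hz hw

/-- The map `Δ_j : E_{j,l}^{p,k-p} → E_{m,j}^{q,h-q}`, where `q = p + j` and `h = k + 1`: for
`α` with witnesses `z_{p+i}` of `α ∈ Z_j^{p,k-p}`, the orthogonal projection of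
`d_j α - ∑_{i=1}^{j-1} d_{j-i} z_{p+i}` onto `(B_j^{q,h-q})^⊥`. It does not depend on the
witnesses. -/
noncomputable def Delta {j : ℕ} (hj : 1 ≤ j) (l m : ℕ) {p q k h : ℤ} (hq : p + j = q)
    (hh : k + 1 = h) : M.E j l p k →ₗ[𝕜] M.E m j q h where
  toFun α := ⟨(M.B j q h)ᗮ.starProjection (M.rawDelta j α α.2.1.2.choose), by
    subst hq hh
    exact M.proj_rawDelta_mem hj m α.2.1.1 α.2.1.2.choose_spec⟩
  map_add' α β := by
    subst hq hh
    apply Subtype.ext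
    simp only [Submodule.coe_add, ← map_add]
    rw [← M.rawDelta_add]
    exact M.proj_rawDelta_eq (α + β).2.1.2.choose_spec
      (α.2.1.2.choose_spec.add β.2.1.2.choose_spec)
  map_smul' c α := by
    subst hq hh
    apply Subtype.ext
    simp only [Submodule.coe_smul, ← map_smul, RingHom.id_apply]
    rw [← M.rawDelta_smul]
    exact M.proj_rawDelta_eq (c • α).2.1.2.choose_spec (α.2.1.2.choose_spec.smul c)

/-- The map `Δ_j : E_{j,l}^{p,k-p} → E_{m,j}^{p+j,k+1-p-j}` that leaves `E_{j,l}^{p,k-p}`. -/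
noncomputable def deltaOut {j : ℕ} (hj : 1 ≤ j) (l m : ℕ) (p k : ℤ) :
    M.E j l p k →ₗ[𝕜] M.E m j (p + j) (k + 1) :=
  M.Delta hj l m rfl rfl

/-- The map `Δ_l : E_{l,m}^{p-l,k-1-p+l} → E_{j,l}^{p,k-p}` that arrives at `E_{j,l}^{p,k-p}`. -/
noncomputable def deltaIn (j : ℕ) {l : ℕ} (hl : 1 ≤ l) (m : ℕ) (p k : ℤ) :
    M.E l m (p - l) (k - 1) →ₗ[𝕜] M.E j l p k :=
  M.Delta hl m j (sub_add_cancel p (l : ℤ)) (sub_add_cancel k 1)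

/-- The cohomology at the middle term of
`E_{l,m₁}^{p-l,k-1-p+l} → E_{j,l}^{p,k-p} → E_{m₂,j}^{p+j,k+1-p-j}`. -/
abbrev SpectralCohomology {j l : ℕ} (hj : 1 ≤ j) (hl : 1 ≤ l) (m₁ m₂ : ℕ) (p k : ℤ) : Type _ :=
  LinearMap.ker (M.deltaOut hj l m₂ p k) ⧸
    (LinearMap.range (M.deltaIn j hl m₁ p k)).submoduleOf (LinearMap.ker (M.deltaOut hj l m₂ p k))

/-- The set `I_{p,k}` of the pages `j ≥ 1` whose differential
`Δ_j : Z_j^{p,k-p}/B_j^{p,k-p} → Z_j^{p+j,k+1-p-j}/B_j^{p+j,k+1-p-j}` is not zero, the quotients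
being represented by the spaces `E_{j,j}`. -/
def I (p k : ℤ) : Set ℕ := {j | ∃ hj : 1 ≤ j, M.deltaOut hj j j p k ≠ 0}

end Spectral

end Multicomplex

/-!
The proof reads the multicomplex as a filtered complex. An element of degree `k` of the total
complex is a family `u` of components `u a` of weight `a`; the families vanishing below weight `p`
form the filtration step `families p k`, and `familyD` is the total differential. In this language
(`mem_Z_iff`, `mem_B_iff`) `Z_r` consists of the leading components of those `u` in the `p`-th step
for which `D u` lies in step `p + r`, and `B_r` of the leading components of those `D u` with `u` in
step `p - r + 1`. If `α = u p` with such a `u`, then `Δ_j α` is the projection of the component of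
weight `p + j` of `D u` (`coe_Delta_eq`).

Subtracting two elements with the same leading component shows that `Δ_j α = 0` exactly when `α`
lies in `Z_{j+1}`, so that on `E_{j,l}` the kernel of `Δ_j` is `Z_{j+1} ∩ B_l^⊥`
(`Delta_eq_zero_iff`). The image of `Δ_l` is `B_{l+1} ∩ B_l^⊥` (`mem_range_Delta_iff`). As `B_l` has
an orthogonal complement and `B_l ⊆ B_{l+1} ⊆ Z_{j+1}`, the quotient of the two is
`Z_{j+1} / B_{l+1}`. The case `j = l` shows that a page differential is nonzero exactly at a jump of
`Z` or of `B`; since both sequences are eventually constant, the last jump is a page after which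
they are stationary.

With finitely many weights, `Z_∞` and `B_∞` consist of the leading components of cocycles and of
coboundaries. Sections of `Z_∞ → E_∞` and of the map from cocycles to leading components give linear
maps `E_∞ → H^k` (`exists_EInf_to_cohomology`). Their sum over all weights is injective because the
lowest weight of a coboundary detects it, and surjective because leading components of a cocycle can
be removed one weight after the other (`exists_directSum_EInf_equiv`).
-/

namespace Multicomplex

/-! ### The filtered complex of families -/

section Families

variable {R V : Type*} [CommRing R] [AddCommGroup V] [Module R V] {s : ℕ}
  (M : Multicomplex R V s)

/-- The families `u` of elements of degree `k`, where `u a` is the component of weight `a`, that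
vanish in the weights below `p`. They are the elements of the `p`-th filtration step of the product
total complex; working with families keeps the components at hand and needs no finiteness. -/
def families (p k : ℤ) : Submodule R (ℤ → V) where
  carrier := {u | ∀ a, u a ∈ M.piece a k ∧ (a < p → u a = 0)}
  zero_mem' a := ⟨zero_mem _, fun _ => rfl⟩
  add_mem' hu hv a := ⟨add_mem (hu a).1 (hv a).1, fun h => by simp [(hu a).2 h, (hv a).2 h]⟩
  smul_mem' c u hu a := ⟨Submodule.smul_mem _ c (hu a).1, fun h => by simp [(hu a).2 h]⟩

/-- The total differential on families: the component of weight `a` of `D u` is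
`∑ i, d i (u (a - i))`. -/
def familyD : (ℤ → V) →ₗ[R] (ℤ → V) :=
  LinearMap.pi fun a => ∑ i ∈ Finset.range (s + 1), M.d i ∘ₗ LinearMap.proj (a - i)

theorem familyD_apply (u : ℤ → V) (a : ℤ) :
    M.familyD u a = ∑ i ∈ Finset.range (s + 1), M.d i (u (a - i)) := by
  simp [familyD]

variable {M}

theorem families_mono {p q : ℤ} (h : q ≤ p) (k : ℤ) : M.families p k ≤ M.families q k :=
  fun _ hu a => ⟨(hu a).1, fun ha => (hu a).2 (by omega)⟩

/-- An element of the `p`-th filtration step without component of weight `p` lies in the next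
step. -/
theorem mem_families_succ {p k : ℤ} {u : ℤ → V} (hu : u ∈ M.families p k) (h : u p = 0) :
    u ∈ M.families (p + 1) k := by
  refine fun a => ⟨(hu a).1, fun ha => ?_⟩
  rcases (Int.lt_add_one_iff.1 ha).lt_or_eq with h1 | rfl
  · exact (hu a).2 h1
  · exact h

theorem familyD_eq_sum_range {p k : ℤ} {u : ℤ → V} (hu : u ∈ M.families p k) {a : ℤ} {n : ℕ}
    (h : a - n < p) : M.familyD u a = ∑ i ∈ Finset.range n, M.d i (u (a - i)) := by
  rw [familyD_apply]
  have hs : ∀ i : ℕ, s + 1 ≤ i → M.d i (u (a - i)) = 0 := fun i hi => by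
    simp [M.d_eq_zero i (by omega)]
  have hn : ∀ i : ℕ, n ≤ i → M.d i (u (a - i)) = 0 := fun i hi => by
    rw [(hu _).2 (by omega), map_zero]
  have h1 : ∀ m m' : ℕ, m ≤ m' → (∀ i : ℕ, m ≤ i → M.d i (u (a - i)) = 0) →
      ∑ i ∈ Finset.range m, M.d i (u (a - i)) = ∑ i ∈ Finset.range m', M.d i (u (a - i)) :=
    fun m m' hm h => Finset.sum_subset (by simpa using hm) fun i _ hi => h i (by simpa using hi)
  rw [h1 _ _ (le_max_left (s + 1) n) hs, ← h1 _ _ (le_max_right (s + 1) n) hn]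

theorem familyD_mem {p k : ℤ} {u : ℤ → V} (hu : u ∈ M.families p k) :
    M.familyD u ∈ M.families p (k + 1) := by
  refine fun a => ⟨?_, fun ha => ?_⟩
  · rw [familyD_apply]
    refine Submodule.sum_mem _ fun i _ => ?_
    simpa using M.d_mem_piece i (hu (a - i)).1
  · rw [familyD_eq_sum_range hu (n := 0) (by simpa using ha), Finset.sum_range_zero]

theorem familyD_mem_of_vanish {p q k : ℤ} {u : ℤ → V} (hu : u ∈ M.families p k)
    (h : ∀ a < q, M.familyD u a = 0) : M.familyD u ∈ M.families q (k + 1) :=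
  fun a => ⟨(familyD_mem hu a).1, h a⟩

theorem familyD_eq_sum_antidiagonal {p k : ℤ} {u : ℤ → V} (hu : u ∈ M.families p k) (n : ℕ) :
    M.familyD u (p + n) =
      ∑ y ∈ Finset.HasAntidiagonal.antidiagonal n, M.d y.1 (u (p + y.2)) := by
  rw [familyD_eq_sum_range hu (n := n + 1) (by push_cast; omega),
    Finset.Nat.sum_antidiagonal_eq_sum_range_succ_mk]
  refine Finset.sum_congr rfl fun i hi => ?_
  rw [Nat.cast_sub (Nat.lt_succ_iff.1 (Finset.mem_range.1 hi)), add_sub_assoc]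

theorem familyD_familyD {p k : ℤ} {u : ℤ → V} (hu : u ∈ M.families p k) :
    M.familyD (M.familyD u) = 0 := by
  ext a
  have hDu := familyD_mem hu
  rcases lt_or_ge a p with ha | ha
  · exact (familyD_mem hDu a).2 ha
  obtain ⟨n, rfl⟩ := Int.le.dest ha
  rw [familyD_eq_sum_antidiagonal hDu, Pi.zero_apply]
  refine Eq.trans (Finset.sum_congr rfl fun y _ => ?_) (M.sum_d_sum_d (fun i => u (p + i)) n)
  rw [familyD_eq_sum_antidiagonal hu]

theorem isWitness_of_family {r : ℕ} {p k : ℤ} {u : ℤ → V} (hr : 1 ≤ r)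
    (hu : u ∈ M.families p k) (h : ∀ a < p + r, M.familyD u a = 0) :
    M.IsWitness r p k (u p) (fun i => -u (p + i)) := by
  refine ⟨fun i _ _ => neg_mem (hu _).1, ?_, fun n hn hnr => ?_⟩
  · have := h p (by omega)
    rwa [familyD_eq_sum_range hu (n := 1) (by simp), Finset.sum_range_one, Nat.cast_zero,
      sub_zero] at this
  · have := h (p + n) (by omega)
    rw [familyD_eq_sum_range hu (n := n + 1) (by push_cast; omega), Finset.sum_range_succ] at this
    simp only [add_sub_cancel_right] at this
    simp only [map_neg, Finset.sum_neg_distrib]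
    rw [eq_neg_of_add_eq_zero_right this]
    refine congrArg Neg.neg (Finset.sum_congr rfl fun i hi => ?_)
    rw [Nat.cast_sub (Finset.mem_range.1 hi).le, add_sub_assoc]

theorem rawDelta_of_family {j : ℕ} {p k : ℤ} {u : ℤ → V} (hj : 1 ≤ j)
    (hu : u ∈ M.families p k) :
    M.familyD u (p + j) = M.d 0 (u (p + j)) + M.rawDelta j (u p) (fun i => -u (p + i)) := by
  rw [familyD_eq_sum_range hu (n := j + 1) (by push_cast; omega), Finset.sum_range_succ,
    ← Nat.Ico_zero_eq_range, Finset.sum_eq_sum_Ico_succ_bot (by omega)]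
  have h1 : ∑ i ∈ Finset.Ico (0 + 1) j, M.d i (u (p + j - i)) =
      ∑ i ∈ Finset.Ico 1 j, M.d (j - i) (u (p + i)) := by
    refine Finset.sum_bij' (fun i _ => j - i) (fun i _ => j - i) ?_ ?_ ?_ ?_ ?_
    all_goals intro i hi; simp only [Finset.mem_Ico] at hi ⊢
    · omega
    · omega
    · omega
    · omega
    · rw [Nat.sub_sub_self hi.2.le, Nat.cast_sub hi.2.le, add_sub_assoc]
  rw [h1]
  simp only [rawDelta, map_neg, Finset.sum_neg_distrib, Nat.cast_zero, sub_zero,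
    add_sub_cancel_right]
  abel

/-- `Z_r` in the language of filtered complexes: the leading components, in weight `p`, of the
elements of the `p`-th filtration step whose differential lies in the `(p + r)`-th one. -/
theorem mem_Z_iff {r : ℕ} (hr : 1 ≤ r) {p k : ℤ} {α : V} :
    α ∈ M.Z r p k ↔
      ∃ u ∈ M.families p k, (∀ a < p + r, M.familyD u a = 0) ∧ u p = α := by
  constructor
  · rintro ⟨hα, z, hz, hz0, hz'⟩
    let u : ℤ → V := fun a =>
      if a = p then α else if p < a ∧ a < p + r then -z (a - p).toNat else 0
    have hup : u p = α := if_pos rfl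
    have hus : ∀ i : ℕ, 1 ≤ i → i < r → u (p + i) = -z i := by
      intro i hi hir
      have h1 : p + (i : ℤ) ≠ p := by omega
      have h2 : p < p + (i : ℤ) ∧ p + (i : ℤ) < p + r := by omega
      simp [u, h1, h2]
    have hu : u ∈ M.families p k := by
      refine fun a => ⟨?_, fun ha => ?_⟩
      · by_cases h1 : a = p
        · subst h1
          rwa [hup]
        by_cases h2 : p < a ∧ a < p + r
        · obtain ⟨i, rfl⟩ := Int.le.dest h2.1.le
          rw [hus i (by omega) (by omega)]
          exact neg_mem (hz i (by omega) (by omega))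
        · simp [u, h1, h2]
      · have h1 : a ≠ p := ha.ne
        have h2 : ¬ (p < a ∧ a < p + r) := by omega
        simp [u, h1, h2]
    refine ⟨u, hu, fun a ha => ?_, hup⟩
    rcases lt_or_ge a p with h1 | h1
    · exact (familyD_mem hu a).2 h1
    obtain ⟨n, rfl⟩ := Int.le.dest h1
    rw [familyD_eq_sum_range hu (n := n + 1) (by push_cast; omega), Finset.sum_range_succ,
      add_sub_cancel_right, hup]
    rcases Nat.eq_zero_or_pos n with rfl | hn
    · simpa using hz0
    · rw [hz' n hn (by omega), ← Finset.sum_add_distrib]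
      refine Finset.sum_eq_zero fun i hi => ?_
      have hi' := Finset.mem_range.1 hi
      rw [add_sub_assoc, ← Nat.cast_sub hi'.le, hus (n - i) (by omega) (by omega), map_neg,
        neg_add_cancel]
  · rintro ⟨u, hu, h, rfl⟩
    exact ⟨(hu p).1, _, isWitness_of_family hr hu h⟩

theorem familyD_eq_sum_Ico {r l : ℕ} {p k : ℤ} {u : ℤ → V}
    (hu : u ∈ M.families (p - r + 1) k) :
    M.familyD u (p - l) = ∑ i ∈ Finset.Ico l r, M.d (i - l) (u (p - i)) := by
  rw [familyD_eq_sum_range hu (n := r - l) (by omega), Finset.sum_Ico_eq_sum_range]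
  refine Finset.sum_congr rfl fun i _ => ?_
  rw [Nat.add_sub_cancel_left, Nat.cast_add, sub_sub]

/-- `B_r` in the language of filtered complexes: the leading components, in weight `p`, of the
differentials of elements of the `(p - r + 1)`-th filtration step. -/
theorem mem_B_iff {r : ℕ} {p k : ℤ} {α : V} :
    α ∈ M.B r p k ↔
      ∃ u ∈ M.families (p - r + 1) (k - 1), (∀ a < p, M.familyD u a = 0) ∧
        M.familyD u p = α := by
  have hsum : ∀ u ∈ M.families (p - r + 1) (k - 1),
      M.familyD u p = ∑ i ∈ Finset.range r, M.d i (u (p - i)) := fun u hu => by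
    simpa [Nat.Ico_zero_eq_range] using familyD_eq_sum_Ico (l := 0) hu
  constructor
  · rintro ⟨c, hc, rfl, hc'⟩
    let u : ℤ → V := fun a => if p - r < a ∧ a ≤ p then c (p - a).toNat else 0
    have huc : ∀ i : ℕ, i < r → u (p - i) = c i := by
      intro i hi
      have h1 : p - r < p - i ∧ p - (i : ℤ) ≤ p := by omega
      simp [u, h1.1]
    have hu : u ∈ M.families (p - r + 1) (k - 1) := by
      refine fun a => ⟨?_, fun ha => ?_⟩
      · by_cases h1 : p - r < a ∧ a ≤ p
        · obtain ⟨i, rfl⟩ : ∃ i : ℕ, a = p - i := ⟨(p - a).toNat, by omega⟩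
          rw [huc i (by omega)]
          exact hc i (by omega)
        · simp [u, h1]
      · have h1 : ¬ (p - r < a ∧ a ≤ p) := by omega
        simp [u, h1]
    refine ⟨u, hu, fun a ha => ?_, ?_⟩
    · obtain ⟨l, rfl⟩ : ∃ l : ℕ, a = p - l := ⟨(p - a).toNat, by omega⟩
      rw [familyD_eq_sum_Ico hu]
      rcases lt_or_ge l r with hl | hl
      · rw [hc' l (by omega) hl]
        exact Finset.sum_congr rfl fun i hi => by rw [huc i (Finset.mem_Ico.1 hi).2]
      · simp [hl]
    · rw [hsum u hu]
      exact Finset.sum_congr rfl fun i hi => by rw [huc i (Finset.mem_range.1 hi)]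
  · rintro ⟨u, hu, h, rfl⟩
    refine ⟨fun i => u (p - i), fun i _ => (hu _).1, hsum u hu, fun l hl _ => ?_⟩
    rw [← familyD_eq_sum_Ico hu, h _ (by omega)]

theorem Z_antitone {r t : ℕ} (hr : 1 ≤ r) (h : r ≤ t) (p k : ℤ) : M.Z t p k ≤ M.Z r p k := by
  intro α hα
  obtain ⟨u, hu, hD, rfl⟩ := (mem_Z_iff (hr.trans h)).1 hα
  exact (mem_Z_iff hr).2 ⟨u, hu, fun a ha => hD a (by omega), rfl⟩

theorem B_monotone {r t : ℕ} (h : r ≤ t) (p k : ℤ) : M.B r p k ≤ M.B t p k := by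
  intro α hα
  obtain ⟨u, hu, hD, rfl⟩ := mem_B_iff.1 hα
  exact mem_B_iff.2 ⟨u, families_mono (by omega) _ hu, hD, rfl⟩

/-- The spectral sequence differential `d_j` vanishes on `[α]` exactly when `α` survives to the
next page. Here `u` is any element with leading component `α` and `D u` of weight at least
`p + j`. -/
theorem familyD_mem_B_iff {j : ℕ} {p q k h : ℤ} (hq : p + j = q) (hh : k + 1 = h) {u : ℤ → V}
    (hu : u ∈ M.families p k) (hD : ∀ a < p + j, M.familyD u a = 0) :
    M.familyD u q ∈ M.B j q h ↔ u p ∈ M.Z (j + 1) p k := by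
  subst hq hh
  rw [mem_B_iff, mem_Z_iff (Nat.le_add_left 1 j)]
  have e1 : p + j - j + 1 = p + 1 := by ring
  have e2 : k + 1 - 1 = k := by ring
  rw [e1, e2]
  constructor
  · rintro ⟨y, hy, hyD, hyq⟩
    refine ⟨u - y, sub_mem hu (families_mono (by omega) _ hy), fun a ha => ?_, ?_⟩
    · rw [map_sub, Pi.sub_apply, sub_eq_zero]
      rcases (Int.lt_add_one_iff.1 (by push_cast at ha; omega : a < p + j + 1)).lt_or_eq with
        h1 | rfl
      · rw [hD a h1, hyD a h1]
      · exact hyq.symm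
    · rw [Pi.sub_apply, (hy p).2 (by omega), sub_zero]
  · rintro ⟨w, hw, hwD, hwp⟩
    refine ⟨u - w, mem_families_succ (sub_mem hu hw) (by simp [hwp]), fun a ha => ?_, ?_⟩
    · rw [map_sub, Pi.sub_apply, hD a ha, hwD a (by push_cast; omega), sub_zero]
    · rw [map_sub, Pi.sub_apply, hwD _ (by push_cast; omega), sub_zero]

end Families

/-! ### The page differentials -/

section PageDifferentials

variable {𝕜 V : Type*} [RCLike 𝕜] [NormedAddCommGroup V] [InnerProductSpace 𝕜 V] {s : ℕ}
  {M : Multicomplex 𝕜 V s}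

theorem d_zero_mem_B {j : ℕ} (hj : 1 ≤ j) {p k : ℤ} {x : V} (hx : x ∈ M.piece p k) :
    M.d 0 x ∈ M.B j p (k + 1) := by
  refine B_monotone hj _ _ ⟨fun _ => x, fun i hi => ?_, by simp, fun l h1 h2 => by omega⟩
  rw [Nat.lt_one_iff.1 hi]
  simpa using hx

theorem exists_sub_mem_orthogonal (K : Submodule 𝕜 V) [K.HasOrthogonalProjection] (x : V) :
    ∃ b ∈ K, x - b ∈ Kᗮ :=
  ⟨_, Submodule.starProjection_apply_mem K x, Submodule.sub_starProjection_mem_orthogonal x⟩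

variable [∀ (r : ℕ) (p k : ℤ), (M.B r p k).HasOrthogonalProjection]

/-- Any element `u` with leading component `α` and `D u` of weight at least `p + j` computes
`Δ_j α`. -/
theorem coe_Delta_eq {j l m : ℕ} (hj : 1 ≤ j) {p q k h : ℤ} (hq : p + j = q) (hh : k + 1 = h)
    (α : M.E j l p k) {u : ℤ → V} (hu : u ∈ M.families p k)
    (hD : ∀ a < p + j, M.familyD u a = 0) (hα : u p = α) :
    (M.Delta hj l m hq hh α : V) = (M.B j q h)ᗮ.starProjection (M.familyD u q) := by
  subst hq hh
  -- The component of weight `p + j` of `u` only contributes an element of `B_j`.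
  rw [rawDelta_of_family hj hu, map_add,
    Submodule.starProjection_orthogonal_apply_eq_zero (d_zero_mem_B hj (hu _).1), zero_add]
  have hw := isWitness_of_family hj hu hD
  rw [hα] at hw ⊢
  exact M.proj_rawDelta_eq α.2.1.2.choose_spec hw

/-- The kernel of `Δ_j` on `E_{j,l}` is `Z_{j+1} ∩ B_l^⊥`. -/
theorem Delta_eq_zero_iff {j l m : ℕ} (hj : 1 ≤ j) {p q k h : ℤ} (hq : p + j = q)
    (hh : k + 1 = h) (α : M.E j l p k) :
    M.Delta hj l m hq hh α = 0 ↔ (α : V) ∈ M.Z (j + 1) p k := by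
  obtain ⟨u, hu, hD, hα⟩ := (mem_Z_iff hj).1 α.2.1
  rw [← Submodule.coe_eq_zero, coe_Delta_eq hj hq hh α hu hD hα,
    Submodule.starProjection_apply_eq_zero_iff, Submodule.orthogonal_orthogonal,
    familyD_mem_B_iff hq hh hu hD, hα]

/-- The image of `Δ_l` in `E_{j,l}` is `B_{l+1} ∩ B_l^⊥`, whatever orthogonality condition is put
on the source: an element of `Z_l` may be changed by an element of `B_m`, which is the leading
component of a cocycle. -/
theorem mem_range_Delta_iff {j l m : ℕ} (hl : 1 ≤ l) {p q k h : ℤ} (hq : p + l = q)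
    (hh : k + 1 = h) (γ : M.E j l q h) :
    γ ∈ LinearMap.range (M.Delta hl m j hq hh) ↔ (γ : V) ∈ M.B (l + 1) q h := by
  have eqp : q - (l + 1 : ℕ) + 1 = p := by push_cast; omega
  have eqk : h - 1 = k := by omega
  constructor
  · rintro ⟨β, rfl⟩
    obtain ⟨u, hu, hD, hβ⟩ := (mem_Z_iff hl).1 β.2.1
    rw [coe_Delta_eq hl hq hh β hu hD hβ, Submodule.starProjection_orthogonal_val]
    refine sub_mem (mem_B_iff.2 ⟨u, by rwa [eqp, eqk], fun a ha => hD a (by omega), rfl⟩)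
      (B_monotone (Nat.le_succ l) _ _ (Submodule.starProjection_apply_mem _ _))
  · intro hγ
    obtain ⟨u, hu, hD, hγ⟩ := mem_B_iff.1 hγ
    rw [eqp, eqk] at hu
    obtain ⟨b, hb, hbo⟩ := exists_sub_mem_orthogonal (M.B m p k) (u p)
    obtain ⟨w, hw, hwD, rfl⟩ := (mem_Z_iff (Nat.le_add_left 1 l)).1 (M.B_le_Z m (l + 1) p k hb)
    have huw : u - w ∈ M.families p k := sub_mem hu hw
    have hDuw : ∀ a < p + l, M.familyD (u - w) a = 0 := fun a ha => by
      rw [map_sub, Pi.sub_apply, hD a (by omega), hwD a (by push_cast; omega), sub_zero]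
    refine ⟨⟨u p - w p, (mem_Z_iff hl).2 ⟨_, huw, hDuw, rfl⟩, hbo⟩, Subtype.ext ?_⟩
    rw [coe_Delta_eq hl hq hh _ huw hDuw rfl, map_sub, Pi.sub_apply, hγ,
      hwD q (by push_cast; omega), sub_zero]
    exact Submodule.starProjection_eq_self_iff.2 γ.2.2

theorem Delta_eq_zero_iff_Z {j m : ℕ} (hj : 1 ≤ j) {p q k h : ℤ} (hq : p + j = q)
    (hh : k + 1 = h) : M.Delta hj j m hq hh = 0 ↔ M.Z (j + 1) p k = M.Z j p k := by
  constructor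
  · intro h0
    refine le_antisymm (Z_antitone hj (Nat.le_succ j) _ _) fun x hx => ?_
    obtain ⟨b, hb, hbo⟩ := exists_sub_mem_orthogonal (M.B j p k) x
    have h1 : x - b ∈ M.Z (j + 1) p k := (Delta_eq_zero_iff (l := j) (m := m) hj hq hh
      ⟨x - b, sub_mem hx (M.B_le_Z j j _ _ hb), hbo⟩).1 (by rw [h0, LinearMap.zero_apply])
    simpa using add_mem h1 (M.B_le_Z j (j + 1) _ _ hb)
  · intro h0
    ext1 α
    exact (Delta_eq_zero_iff hj hq hh α).2 (by rw [h0]; exact α.2.1)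

theorem Delta_eq_zero_iff_B {l m : ℕ} (hl : 1 ≤ l) {p q k h : ℤ} (hq : p + l = q)
    (hh : k + 1 = h) : M.Delta hl m l hq hh = 0 ↔ M.B (l + 1) q h = M.B l q h := by
  constructor
  · intro h0
    refine le_antisymm (fun x hx => ?_) (B_monotone (Nat.le_succ l) _ _)
    obtain ⟨b, hb, hbo⟩ := exists_sub_mem_orthogonal (M.B l q h) x
    have h1 : x - b ∈ M.B (l + 1) q h := sub_mem hx (B_monotone (Nat.le_succ l) _ _ hb)
    obtain ⟨β, hβ⟩ := (mem_range_Delta_iff (m := m) hl hq hh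
      ⟨x - b, M.B_le_Z (l + 1) l _ _ h1, hbo⟩).2 h1
    rw [h0, LinearMap.zero_apply] at hβ
    have h2 : x - b = 0 := congrArg Subtype.val hβ.symm
    rwa [sub_eq_zero.1 h2]
  · intro h0
    ext1 α
    have h1 := (mem_range_Delta_iff hl hq hh _).1
      (LinearMap.mem_range_self (M.Delta hl m l hq hh) α)
    rw [h0] at h1
    exact Subtype.ext (Submodule.disjoint_def.1 (Submodule.orthogonal_disjoint _) _ h1
      (M.Delta hl m l hq hh α).2.2)

/-- The cohomology of a spectral complex is `Z_{j+1} / B_{l+1}`: its cocycles `Z_{j+1} ∩ B_l^⊥`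
represent every class of `Z_{j+1}` modulo `B_l`, and its coboundaries are `B_{l+1} ∩ B_l^⊥`. -/
theorem exists_spectralCohomology_equiv {j l : ℕ} (hj : 1 ≤ j) (hl : 1 ≤ l) (m₁ m₂ : ℕ)
    (p k : ℤ) :
    ∃ e : M.SpectralCohomology hj hl m₁ m₂ p k ≃ₗ[𝕜]
        (M.Z (j + 1) p k ⧸ (M.B (l + 1) p k).submoduleOf (M.Z (j + 1) p k)),
      ∀ x : LinearMap.ker (M.deltaOut hj l m₂ p k),
        ∃ hx : ((x : M.E j l p k) : V) ∈ M.Z (j + 1) p k,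
          e (Submodule.Quotient.mk x) = Submodule.Quotient.mk ⟨((x : M.E j l p k) : V), hx⟩ := by
  have hker : ∀ x : LinearMap.ker (M.deltaOut hj l m₂ p k),
      ((x : M.E j l p k) : V) ∈ M.Z (j + 1) p k := fun x =>
    (Delta_eq_zero_iff hj rfl rfl _).1 (LinearMap.mem_ker.1 x.2)
  let f : LinearMap.ker (M.deltaOut hj l m₂ p k) →ₗ[𝕜]
      (M.Z (j + 1) p k ⧸ (M.B (l + 1) p k).submoduleOf (M.Z (j + 1) p k)) :=
    Submodule.mkQ _ ∘ₗ
      LinearMap.codRestrict _ ((M.E j l p k).subtype ∘ₗ Submodule.subtype _) hker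
  have hfk : LinearMap.ker f = (LinearMap.range (M.deltaIn j hl m₁ p k)).submoduleOf
      (LinearMap.ker (M.deltaOut hj l m₂ p k)) := by
    ext x
    rw [LinearMap.mem_ker]
    refine (Submodule.Quotient.mk_eq_zero _).trans ?_
    exact (mem_range_Delta_iff hl (sub_add_cancel p (l : ℤ)) (sub_add_cancel k 1)
      (x : M.E j l p k)).symm
  have hfs : Function.Surjective f := by
    intro y
    obtain ⟨y, rfl⟩ := Submodule.Quotient.mk_surjective _ y
    obtain ⟨b, hb, hbo⟩ := exists_sub_mem_orthogonal (M.B l p k) (y : V)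
    have h1 : (y : V) - b ∈ M.Z (j + 1) p k := sub_mem y.2 (M.B_le_Z l (j + 1) _ _ hb)
    let x : M.E j l p k := ⟨y - b, Z_antitone hj (Nat.le_succ j) _ _ h1, hbo⟩
    refine ⟨⟨x, LinearMap.mem_ker.2 ((Delta_eq_zero_iff hj rfl rfl x).2 h1)⟩, ?_⟩
    refine (Submodule.Quotient.eq _).2 ?_
    change (y : V) - b - y ∈ M.B (l + 1) p k
    rw [sub_sub_cancel_left]
    exact neg_mem (B_monotone (Nat.le_succ l) _ _ hb)
  exact ⟨(Submodule.quotEquivOfEq _ _ hfk.symm).trans (f.quotKerEquivOfSurjective hfs),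
    fun x => ⟨hker x, rfl⟩⟩

theorem deltaOut_comp_deltaIn {j l : ℕ} (hj : 1 ≤ j) (hl : 1 ≤ l) (m₁ m₂ : ℕ) (p k : ℤ) :
    M.deltaOut hj l m₂ p k ∘ₗ M.deltaIn j hl m₁ p k = 0 := by
  ext1 x
  exact (Delta_eq_zero_iff hj rfl rfl _).2 (M.B_le_Z (l + 1) _ _ _
    ((mem_range_Delta_iff hl _ _ _).1 (LinearMap.mem_range_self (M.deltaIn j hl m₁ p k) x)))

theorem mem_I_iff {j : ℕ} {p k : ℤ} : j ∈ M.I p k ↔ 1 ≤ j ∧ M.Z (j + 1) p k ≠ M.Z j p k :=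
  ⟨fun ⟨hj, h⟩ => ⟨hj, fun h' => h ((Delta_eq_zero_iff_Z hj rfl rfl).2 h')⟩,
    fun ⟨hj, h⟩ => ⟨hj, fun h' => h ((Delta_eq_zero_iff_Z hj rfl rfl).1 h')⟩⟩

theorem mem_I_sub_iff {l : ℕ} {p k : ℤ} :
    l ∈ M.I (p - l) (k - 1) ↔ 1 ≤ l ∧ M.B (l + 1) p k ≠ M.B l p k := by
  have h (hl : 1 ≤ l) : M.deltaOut hl l l (p - l) (k - 1) = 0 ↔
      M.B (l + 1) p k = M.B l p k := by
    refine (Delta_eq_zero_iff_B hl rfl rfl).trans ?_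
    rw [sub_add_cancel, sub_add_cancel]
  exact ⟨fun ⟨hl, h'⟩ => ⟨hl, (h hl).not.1 h'⟩, fun ⟨hl, h'⟩ => ⟨hl, (h hl).not.2 h'⟩⟩

end PageDifferentials

/-! ### Eventually constant sequences -/

section Stabilization

/-- A sequence that is eventually constant has stabilized after its last jump; without a jump,
every index will do. -/
theorem exists_stable_index {X : Type*} (f : ℕ → X) (c : X) {N : ℕ} (hN : ∀ n, N ≤ n → f n = c) :
    ∃ J : ℕ, 1 ≤ J ∧ f (J + 1) = c ∧
      (f (J + 1) ≠ f J ∨ ∀ j, 1 ≤ j → f (j + 1) = f j) := by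
  classical
  -- If no index beyond `J` is a jump, then `f` equals `c` from `J + 1` on.
  have hconst : ∀ J : ℕ, (∀ j, J < j → f (j + 1) = f j) → f (J + 1) = c := by
    intro J hJ
    have h1 : ∀ n : ℕ, f (J + 1 + n) = f (J + 1) := by
      intro n
      induction n with
      | zero => rfl
      | succ n ih => exact (hJ (J + 1 + n) (by omega)).trans ih
    rw [← h1 N, hN _ (by omega)]
  by_cases h : ∃ j, 1 ≤ j ∧ f (j + 1) ≠ f j
  · obtain ⟨j, hj1, hj⟩ := h
    have hb : ∀ i, f (i + 1) ≠ f i → i ≤ N := by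
      intro i hi
      by_contra! h2
      exact hi (by rw [hN _ (by omega), hN _ h2.le])
    have hspec := Nat.findGreatest_spec (P := fun i => f (i + 1) ≠ f i) (hb j hj) hj
    refine ⟨_, hj1.trans (Nat.le_findGreatest (hb j hj) hj), hconst _ fun i hi => ?_,
      Or.inl hspec⟩
    by_contra h2
    exact absurd (Nat.le_findGreatest (hb i h2) h2) (not_le.2 hi)
  · push Not at h
    exact ⟨1, le_rfl, hconst 1 fun j hj => h j hj.le, Or.inr h⟩

end Stabilization

/-! ### Finitely many weights -/

section FiniteWeights

variable {R V : Type*} [CommRing R] [AddCommGroup V] [Module R V] {s : ℕ}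
  {M : Multicomplex R V s}

variable (M) in
/-- All the weights that occur lie between `-N` and `N`. -/
def WeightsBoundedBy (N : ℕ) : Prop := ∀ a k : ℤ, a ∉ Finset.Icc (-N : ℤ) N → M.piece a k = ⊥

theorem FiniteWeights.exists_bound (h : M.FiniteWeights) : ∃ N : ℕ, M.WeightsBoundedBy N := by
  obtain ⟨b, hb⟩ := h.bddAbove
  obtain ⟨c, hc⟩ := h.bddBelow
  refine ⟨b.natAbs + c.natAbs, fun a k ha => ?_⟩
  by_contra h'
  have h1 : a ≤ b := hb ⟨_, h'⟩
  have h2 : c ≤ a := hc ⟨_, h'⟩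
  refine ha (Finset.mem_Icc.2 ⟨?_, ?_⟩) <;> omega

namespace WeightsBoundedBy

variable {N : ℕ} (hN : M.WeightsBoundedBy N)
include hN

theorem eq_zero {a k : ℤ} {x : V} (hx : x ∈ M.piece a k) (ha : a ∉ Finset.Icc (-N : ℤ) N) :
    x = 0 := by
  rwa [hN a k ha, Submodule.mem_bot] at hx

theorem families_le (p k : ℤ) : M.families p k ≤ M.families (-N) k := fun u hu a =>
  ⟨(hu a).1, fun ha => hN.eq_zero (hu a).1 (by simp only [Finset.mem_Icc]; omega)⟩

theorem familyD_eq_zero {p q k : ℤ} {u : ℤ → V} (hu : u ∈ M.families p k) (hq : (N : ℤ) < q)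
    (h : ∀ a < q, M.familyD u a = 0) : M.familyD u = 0 := by
  ext a
  rcases lt_or_ge a q with ha | ha
  · exact h a ha
  · exact hN.eq_zero (familyD_mem hu a).1 (by simp only [Finset.mem_Icc]; omega)

/-- In a fixed weight the modules `Z_r` become stationary. -/
theorem Z_eq_ZInf {p k : ℤ} {r : ℕ} (hr : 1 ≤ r) (h : (N : ℤ) < p + r) :
    M.Z r p k = M.ZInf p k := by
  refine le_antisymm (le_iInf₂ fun t ht => ?_) (iInf₂_le r hr)
  intro α hα
  obtain ⟨u, hu, hD, rfl⟩ := (mem_Z_iff hr).1 hα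
  exact (mem_Z_iff ht).2 ⟨u, hu, fun a _ => congrFun (hN.familyD_eq_zero hu h hD) a, rfl⟩

/-- In a fixed weight the modules `B_r` become stationary. -/
theorem B_eq_BInf {p k : ℤ} {r : ℕ} (hr : 1 ≤ r) (h : p - r + 1 ≤ -N) :
    M.B r p k = M.BInf p k := by
  refine le_antisymm (le_iSup₂_of_le r hr le_rfl) (iSup₂_le fun t _ => ?_)
  intro α hα
  obtain ⟨u, hu, hD, rfl⟩ := mem_B_iff.1 hα
  exact mem_B_iff.2 ⟨u, families_mono h _ (hN.families_le _ _ hu), hD, rfl⟩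

/-- `Z_∞` consists of the leading components of cocycles. -/
theorem mem_ZInf_iff {p k : ℤ} {α : V} :
    α ∈ M.ZInf p k ↔ ∃ u ∈ M.families p k, M.familyD u = 0 ∧ u p = α := by
  have h1 : 1 ≤ N + p.natAbs + 1 := by omega
  have h2 : (N : ℤ) < p + (N + p.natAbs + 1 : ℕ) := by omega
  rw [← hN.Z_eq_ZInf h1 h2, mem_Z_iff h1]
  constructor
  · rintro ⟨u, hu, hD, rfl⟩
    exact ⟨u, hu, hN.familyD_eq_zero hu h2 hD, rfl⟩
  · rintro ⟨u, hu, hD, rfl⟩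
    exact ⟨u, hu, fun a _ => congrFun hD a, rfl⟩

/-- `B_∞` consists of the leading components of coboundaries. -/
theorem mem_BInf_iff {p k : ℤ} {α : V} :
    α ∈ M.BInf p k ↔
      ∃ u ∈ M.families (-N) (k - 1), (∀ a < p, M.familyD u a = 0) ∧ M.familyD u p = α := by
  have h1 : 1 ≤ N + p.natAbs + 1 := by omega
  have h2 : p - (N + p.natAbs + 1 : ℕ) + 1 ≤ -N := by omega
  rw [← hN.B_eq_BInf h1 h2, mem_B_iff]
  constructor
  · rintro ⟨u, hu, hD, rfl⟩
    exact ⟨u, hN.families_le _ _ hu, hD, rfl⟩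
  · rintro ⟨u, hu, hD, rfl⟩
    exact ⟨u, families_mono h2 _ hu, hD, rfl⟩

end WeightsBoundedBy

variable (R V) in
/-- The sum of the components of weight between `-N` and `N` of a family. -/
noncomputable def sumComponents (N : ℕ) : (ℤ → V) →ₗ[R] V :=
  ∑ a ∈ Finset.Icc (-N : ℤ) N, LinearMap.proj a

theorem sumComponents_apply (N : ℕ) (u : ℤ → V) :
    sumComponents R V N u = ∑ a ∈ Finset.Icc (-N : ℤ) N, u a := by
  simp [sumComponents]

theorem single_mem_families {p a k : ℤ} (h : p ≤ a) {x : V} (hx : x ∈ M.piece a k) :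
    Pi.single a x ∈ M.families p k := by
  refine fun b => ⟨?_, fun hb => by rw [Pi.single_eq_of_ne (by omega)]⟩
  rcases eq_or_ne b a with rfl | hb
  · rwa [Pi.single_eq_same]
  · rw [Pi.single_eq_of_ne hb]
    exact zero_mem _

theorem iSupIndep_piece (M : Multicomplex R V s) (k : ℤ) :
    iSupIndep fun a : ℤ => M.piece a k :=
  M.isInternal.submodule_iSupIndep.comp (f := fun a : ℤ => (a, k - a))
    fun _ _ h => congrArg Prod.fst h

namespace WeightsBoundedBy

variable {N : ℕ} (hN : M.WeightsBoundedBy N)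
include hN

theorem sumComponents_single {a k : ℤ} {x : V} (hx : x ∈ M.piece a k) :
    sumComponents R V N (Pi.single a x) = x := by
  rw [sumComponents_apply, Finset.sum_eq_single a (fun b _ hb => by rw [Pi.single_eq_of_ne hb]),
    Pi.single_eq_same]
  intro h
  rw [Pi.single_eq_same, hN.eq_zero hx h]

theorem map_sumComponents (p k : ℤ) :
    (M.families p k).map (sumComponents R V N) = M.weightFiltration p k := by
  refine le_antisymm (Submodule.map_le_iff_le_comap.2 fun u hu => ?_)
    (iSup₂_le fun a ha x hx =>
      ⟨_, single_mem_families ha hx, hN.sumComponents_single hx⟩)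
  rw [Submodule.mem_comap, sumComponents_apply]
  refine Submodule.sum_mem _ fun a _ => ?_
  rcases lt_or_ge a p with ha | ha
  · rw [(hu a).2 ha]
    exact zero_mem _
  · exact Submodule.mem_iSup_of_mem a (Submodule.mem_iSup_of_mem ha (hu a).1)

theorem map_sumComponents_eq_Tot (k : ℤ) :
    (M.families (-N) k).map (sumComponents R V N) = M.Tot k := by
  rw [hN.map_sumComponents]
  refine le_antisymm (iSup₂_le fun a _ => le_iSup (fun a => M.piece a k) a)
    (iSup_le fun a => ?_)
  rcases lt_or_ge a (-N) with ha | ha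
  · rw [hN a k (by simp only [Finset.mem_Icc]; omega)]
    exact bot_le
  · exact le_iSup₂_of_le a ha le_rfl

theorem sumComponents_eq_zero {p k : ℤ} {u : ℤ → V} (hu : u ∈ M.families p k)
    (h : sumComponents R V N u = 0) : u = 0 := by
  rw [sumComponents_apply] at h
  ext a
  by_cases ha : a ∈ Finset.Icc (-N : ℤ) N
  · exact (iSupIndep_iff_finsetSum_eq_zero_imp_eq_zero _).1 (M.iSupIndep_piece k) _ _
      (fun b _ => (hu b).1) h a ha
  · exact hN.eq_zero (hu a).1 ha

/-- Summation of components carries `D` to the total differential. -/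
theorem totalD_sumComponents {p k : ℤ} {u : ℤ → V} (hu : u ∈ M.families p k) :
    M.totalD (sumComponents R V N u) = sumComponents R V N (M.familyD u) := by
  have hf : ∀ v : ℤ → V, (∀ a ∉ Finset.Icc (-N : ℤ) N, v a = 0) →
      ∑ a ∈ Finset.Icc (-N : ℤ) N, v a = ∑ᶠ a, v a := fun v hv =>
    (finsum_eq_sum_of_support_subset v fun a ha => by
      by_contra h
      exact ha (hv a h)).symm
  rw [totalD, LinearMap.sum_apply]
  simp only [sumComponents_apply, familyD_apply]
  rw [Finset.sum_comm (s := Finset.Icc (-N : ℤ) N)]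
  refine Finset.sum_congr rfl fun i _ => ?_
  rw [map_sum, hf (fun a => M.d i (u a)) fun a ha => by rw [hN.eq_zero (hu a).1 ha, map_zero],
    hf (fun a => M.d i (u (a - i))) fun a ha => hN.eq_zero (k := k + 1)
      (by simpa using M.d_mem_piece i (hu (a - i)).1) ha]
  exact (finsum_comp_equiv (f := fun a => M.d i (u a)) (Equiv.subRight (i : ℤ))).symm

end WeightsBoundedBy

end FiniteWeights

/-! ### The cohomology of the total complex -/

section Cohomology

variable {K V : Type*} [Field K] [AddCommGroup V] [Module K V] {s : ℕ}
  {M : Multicomplex K V s}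

variable (M) in
/-- The cocycles among the families of degree `k` in the `p`-th filtration step. -/
def cocycleFamilies (p k : ℤ) : Submodule K (ℤ → V) :=
  LinearMap.ker M.familyD ⊓ M.families p k

namespace WeightsBoundedBy

variable {N : ℕ} (hN : M.WeightsBoundedBy N)
include hN

theorem sumComponents_mem_cocycles {p k : ℤ} {u : ℤ → V} (hu : u ∈ M.cocycleFamilies p k) :
    sumComponents K V N u ∈ M.cocycles k := by
  refine ⟨LinearMap.mem_ker.2 ?_, ?_⟩
  · rw [hN.totalD_sumComponents hu.2, LinearMap.mem_ker.1 hu.1, map_zero]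
  · rw [← hN.map_sumComponents_eq_Tot]
    exact Submodule.mem_map_of_mem (hN.families_le _ _ hu.2)

/-- The cohomology class of a cocycle family. -/
noncomputable def cohomologyClass (p k : ℤ) : M.cocycleFamilies p k →ₗ[K] M.TotalCohomology k :=
  Submodule.mkQ _ ∘ₗ
    LinearMap.codRestrict _ (sumComponents K V N ∘ₗ (M.cocycleFamilies p k).subtype)
      fun u => hN.sumComponents_mem_cocycles u.2

theorem cohomologyClass_apply {p k : ℤ} (u : M.cocycleFamilies p k) :
    hN.cohomologyClass p k u =
      Submodule.Quotient.mk ⟨_, hN.sumComponents_mem_cocycles u.2⟩ := rfl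

theorem cohomologyClass_eq_zero_iff {p k : ℤ} (u : M.cocycleFamilies p k) :
    hN.cohomologyClass p k u = 0 ↔ ∃ y ∈ M.families (-N) (k - 1), M.familyD y = u := by
  rw [cohomologyClass_apply, Submodule.Quotient.mk_eq_zero]
  change sumComponents K V N (u : ℤ → V) ∈ M.coboundaries k ↔ _
  rw [coboundaries, ← hN.map_sumComponents_eq_Tot]
  constructor
  · rintro ⟨_, ⟨y, hy, rfl⟩, h⟩
    rw [hN.totalD_sumComponents hy, ← sub_eq_zero, ← map_sub] at h
    have h1 := familyD_mem hy
    rw [sub_add_cancel] at h1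
    exact ⟨y, hy, sub_eq_zero.1
      (hN.sumComponents_eq_zero (sub_mem h1 (hN.families_le _ _ u.2.2)) h)⟩
  · rintro ⟨y, hy, h⟩
    exact ⟨_, Submodule.mem_map_of_mem hy, by rw [hN.totalD_sumComponents hy, h]⟩

theorem cohomologyClass_surjective (k : ℤ) :
    Function.Surjective (hN.cohomologyClass (-N) k) := by
  intro c
  obtain ⟨⟨x, hx, hx'⟩, rfl⟩ := Submodule.Quotient.mk_surjective _ c
  rw [← hN.map_sumComponents_eq_Tot] at hx'
  obtain ⟨u, hu, rfl⟩ := hx'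
  have hx0 : M.totalD (sumComponents K V N u) = 0 := hx
  rw [hN.totalD_sumComponents hu] at hx0
  exact ⟨⟨u, LinearMap.mem_ker.2 (hN.sumComponents_eq_zero (familyD_mem hu) hx0), hu⟩, rfl⟩

/-- Linear maps `E_∞ → H^k` that send the class of `α` to the class of a cocycle with leading
component `α`. A linear choice of cocycles on `Z_∞` need not send `B_∞` to coboundaries, so it is
composed with a linear choice of representatives in `Z_∞` of the classes in `E_∞`. -/
theorem exists_EInf_to_cohomology (p k : ℤ) :
    ∃ φ : M.EInf p k →ₗ[K] M.TotalCohomology k, ∀ α : M.ZInf p k,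
      ∃ u : M.cocycleFamilies p k, (u : ℤ → V) p = α ∧
        φ (Submodule.Quotient.mk α) = hN.cohomologyClass p k u := by
  let lead : M.cocycleFamilies p k →ₗ[K] M.ZInf p k :=
    LinearMap.codRestrict _ (LinearMap.proj p ∘ₗ (M.cocycleFamilies p k).subtype) fun u =>
      hN.mem_ZInf_iff.2 ⟨u, u.2.2, u.2.1, rfl⟩
  have hlead : Function.Surjective lead := by
    rintro ⟨α, hα⟩
    obtain ⟨u, hu, hD, rfl⟩ := hN.mem_ZInf_iff.1 hα
    exact ⟨⟨u, hD, hu⟩, rfl⟩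
  obtain ⟨σ, hσ⟩ := lead.exists_rightInverse_of_surjective (LinearMap.range_eq_top.2 hlead)
  obtain ⟨τ, hτ⟩ := ((M.BInf p k).submoduleOf (M.ZInf p k)).mkQ.exists_rightInverse_of_surjective
    (Submodule.range_mkQ _)
  refine ⟨hN.cohomologyClass p k ∘ₗ σ ∘ₗ τ, fun α => ?_⟩
  set α' : M.ZInf p k := τ (Submodule.Quotient.mk α) with hα'
  have hlead' : (σ α' : ℤ → V) p = α' := congrArg Subtype.val (LinearMap.congr_fun hσ α')
  -- The representative `α'` differs from `α` by the leading component of a coboundary `D y`.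
  have hdiff : (α' : V) - α ∈ M.BInf p k :=
    (Submodule.Quotient.eq ((M.BInf p k).submoduleOf (M.ZInf p k))).1
      (LinearMap.congr_fun hτ (Submodule.Quotient.mk α))
  obtain ⟨y, hy, hyD, hyp⟩ := hN.mem_BInf_iff.1 hdiff
  have hDy : M.familyD y ∈ M.families p k := by
    simpa using familyD_mem_of_vanish hy hyD
  let b : M.cocycleFamilies p k := ⟨_, LinearMap.mem_ker.2 (familyD_familyD hy), hDy⟩
  refine ⟨σ α' - b, ?_, ?_⟩
  · change (σ α' : ℤ → V) p - M.familyD y p = α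
    rw [hlead', hyp, sub_sub_cancel]
  · rw [map_sub, (hN.cohomologyClass_eq_zero_iff b).2 ⟨y, hy, rfl⟩, sub_zero]
    rfl

/-- The cohomology of the total complex is the direct sum of the limit terms. -/
theorem exists_directSum_EInf_equiv (k : ℤ) :
    ∃ Φ : (⨁ p : ℤ, M.EInf p k) ≃ₗ[K] M.TotalCohomology k,
      ∀ (p : ℤ) (α : M.ZInf p k), ∃ x : M.cocycles k,
        (x : V) - (α : V) ∈ M.weightFiltration (p + 1) k ∧
        Φ (DirectSum.lof K ℤ (fun q => M.EInf q k) p (Submodule.Quotient.mk α)) =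
          Submodule.Quotient.mk x := by
  classical
  choose φ hφ using fun p => hN.exists_EInf_to_cohomology p k
  obtain ⟨Φ, hΦ⟩ : ∃ Φ : (⨁ p : ℤ, M.EInf p k) →ₗ[K] M.TotalCohomology k,
      ∀ p e, Φ (DirectSum.lof K ℤ (fun q => M.EInf q k) p e) = φ p e :=
    ⟨DirectSum.toModule K ℤ (M.TotalCohomology k) φ, fun p e =>
      DirectSum.toModule_lof (M := fun q => M.EInf q k) (φ := φ) K p e⟩
  have hinj : Function.Injective Φ := by
    rw [injective_iff_map_eq_zero]
    intro x hx
    by_contra hne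
    have hsupp : (DFinsupp.support x).Nonempty := by
      rw [Finset.nonempty_iff_ne_empty]
      exact fun h => hne (DFinsupp.support_eq_empty.1 h)
    -- The lowest weight in which `x` does not vanish.
    set p := (DFinsupp.support x).min' hsupp with hp
    have hpx : x p ≠ 0 := DFinsupp.mem_support_iff.1 (Finset.min'_mem _ hsupp)
    choose α hα using fun q => Submodule.Quotient.mk_surjective _ (x q)
    choose u hu hφu using fun q => hφ q (α q)
    let w : M.cocycleFamilies (-N) k := ∑ q ∈ DFinsupp.support x,
      ⟨u q, (u q).2.1, hN.families_le _ _ (u q).2.2⟩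
    have hw : hN.cohomologyClass (-N) k w = 0 := by
      rw [map_sum, ← hx]
      conv_rhs => rw [← DirectSum.sum_support_of x, map_sum]
      refine Finset.sum_congr rfl fun q _ => ?_
      refine Eq.trans ?_ (hΦ q (x q)).symm
      rw [← hα q, hφu q]
      rfl
    obtain ⟨y, hy, hyw⟩ := (hN.cohomologyClass_eq_zero_iff w).1 hw
    have hwa : ∀ a, (w : ℤ → V) a = ∑ q ∈ DFinsupp.support x, (u q : ℤ → V) a := fun a => by
      simp [w]
    refine hpx ?_
    rw [← hα p]
    refine (Submodule.Quotient.mk_eq_zero _).2 ?_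
    change (α p : V) ∈ M.BInf p k
    refine hN.mem_BInf_iff.2 ⟨y, hy, fun a ha => ?_, ?_⟩
    · rw [hyw, hwa]
      exact Finset.sum_eq_zero fun q hq =>
        ((u q).2.2 a).2 (ha.trans_le (Finset.min'_le _ q hq))
    · rw [hyw, hwa, Finset.sum_eq_single p, hu]
      · exact fun q hq hqp =>
          ((u q).2.2 p).2 (lt_of_le_of_ne (Finset.min'_le _ q hq) hqp.symm)
      · exact fun h => absurd (Finset.min'_mem _ hsupp) h
  -- A class is reached by removing leading components of a cocycle, one weight after the other.
  have hrange : ∀ (n : ℕ) (p : ℤ), (N : ℤ) < p + n → ∀ v : M.cocycleFamilies p k,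
      hN.cohomologyClass p k v ∈ LinearMap.range Φ := by
    intro n
    induction n with
    | zero =>
      intro p hp v
      have hv : v = 0 := by
        ext a
        rcases lt_or_ge a p with ha | ha
        · exact (v.2.2 a).2 ha
        · exact hN.eq_zero (v.2.2 a).1 (by simp only [Finset.mem_Icc]; omega)
      rw [hv, map_zero]
      exact zero_mem _
    | succ n ih =>
      intro p hp v
      obtain ⟨u, hu, hφu⟩ := hφ p ⟨(v : ℤ → V) p, hN.mem_ZInf_iff.2 ⟨v, v.2.2, v.2.1, rfl⟩⟩
      have hvu : (v - u : ℤ → V) ∈ M.cocycleFamilies (p + 1) k :=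
        ⟨sub_mem v.2.1 u.2.1, mem_families_succ (sub_mem v.2.2 u.2.2) (by simp [hu])⟩
      have h1 : hN.cohomologyClass p k v =
          hN.cohomologyClass p k u + hN.cohomologyClass (p + 1) k ⟨_, hvu⟩ := by
        rw [← sub_eq_iff_eq_add', ← map_sub]
        rfl
      rw [h1, ← hφu, ← hΦ]
      exact add_mem (LinearMap.mem_range_self _ _) (ih (p + 1) (by push_cast at hp; omega) _)
  have hsurj : Function.Surjective Φ := by
    intro c
    obtain ⟨u, rfl⟩ := hN.cohomologyClass_surjective k c
    exact hrange (2 * N + 1) (-N) (by push_cast; omega) u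
  refine ⟨LinearEquiv.ofBijective Φ ⟨hinj, hsurj⟩, fun p α => ?_⟩
  obtain ⟨u, hu, hφu⟩ := hφ p α
  have hα : (α : V) ∈ M.piece p k := hu ▸ (u.2.2 p).1
  refine ⟨⟨_, hN.sumComponents_mem_cocycles u.2⟩, ?_, (hΦ p _).trans hφu⟩
  change sumComponents K V N u - (α : V) ∈ _
  rw [← hN.map_sumComponents, ← hN.sumComponents_single hα, ← map_sub]
  exact Submodule.mem_map_of_mem (mem_families_succ
    (sub_mem u.2.2 (single_mem_families le_rfl hα)) (by simp [hu]))

end WeightsBoundedBy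

end Cohomology

end Multicomplex

/-! ### The spectral complexes -/

theorem mainTheorem6 {𝕜 V : Type*} [RCLike 𝕜] [NormedAddCommGroup V] [InnerProductSpace 𝕜 V]
    {s : ℕ} (M : Multicomplex 𝕜 V s) (hfin : M.FiniteWeights) (horth : M.WeightsOrthogonal)
    [hB : ∀ (r : ℕ) (p k : ℤ), (M.B r p k).HasOrthogonalProjection] :
    (∀ (p k : ℤ) (j l m₁ m₂ : ℕ) (hj : 1 ≤ j) (hl : 1 ≤ l), 1 ≤ m₁ → 1 ≤ m₂ →
      M.deltaOut hj l m₂ p k ∘ₗ M.deltaIn j hl m₁ p k = 0 ∧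
      M.B (l + 1) p k ≤ M.Z (j + 1) p k ∧
      ∃ e : M.SpectralCohomology hj hl m₁ m₂ p k ≃ₗ[𝕜]
          (M.Z (j + 1) p k ⧸ (M.B (l + 1) p k).submoduleOf (M.Z (j + 1) p k)),
        ∀ x : LinearMap.ker (M.deltaOut hj l m₂ p k),
          ∃ hx : ((x : M.E j l p k) : V) ∈ M.Z (j + 1) p k,
            e (Submodule.Quotient.mk x) = Submodule.Quotient.mk ⟨((x : M.E j l p k) : V), hx⟩) ∧
    (∀ p k : ℤ, ∃ J L : ℕ, 1 ≤ J ∧ 1 ≤ L ∧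
      M.Z (J + 1) p k = M.ZInf p k ∧ M.B (L + 1) p k = M.BInf p k ∧
      (J ∈ M.I p k ∨ M.I p k = ∅) ∧
      (L ∈ M.I (p - L) (k - 1) ∨ ∀ l : ℕ, l ∉ M.I (p - l) (k - 1))) ∧
    (∀ (k : ℤ) (J L m₁ m₂ : ℤ → ℕ) (hJ : ∀ p, 1 ≤ J p) (hL : ∀ p, 1 ≤ L p),
      (∀ p, 1 ≤ m₁ p) → (∀ p, 1 ≤ m₂ p) →
      (∀ p, M.Z (J p + 1) p k = M.ZInf p k) → (∀ p, M.B (L p + 1) p k = M.BInf p k) →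
      ∃ (Ψ : (⨁ p : ℤ, M.SpectralCohomology (hJ p) (hL p) (m₁ p) (m₂ p) p k) ≃ₗ[𝕜]
            (⨁ p : ℤ, M.EInf p k))
        (Φ : (⨁ p : ℤ, M.EInf p k) ≃ₗ[𝕜] M.TotalCohomology k),
        (∀ (p : ℤ) (x : LinearMap.ker (M.deltaOut (hJ p) (L p) (m₂ p) p k)),
          ∃ hx : ((x : M.E (J p) (L p) p k) : V) ∈ M.ZInf p k,
            Ψ (DirectSum.lof 𝕜 ℤ
                (fun q => M.SpectralCohomology (hJ q) (hL q) (m₁ q) (m₂ q) q k) p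
                (Submodule.Quotient.mk x)) =
              DirectSum.lof 𝕜 ℤ (fun q => M.EInf q k) p
                (Submodule.Quotient.mk ⟨((x : M.E (J p) (L p) p k) : V), hx⟩)) ∧
        (∀ (p : ℤ) (α : M.ZInf p k), ∃ x : M.cocycles k,
          (x : V) - (α : V) ∈ M.weightFiltration (p + 1) k ∧
          Φ (DirectSum.lof 𝕜 ℤ (fun q => M.EInf q k) p (Submodule.Quotient.mk α)) =
            Submodule.Quotient.mk x)) := by
  obtain ⟨N, hN⟩ := hfin.exists_bound
  refine ⟨fun p k j l m₁ m₂ hj hl _ _ => ⟨Multicomplex.deltaOut_comp_deltaIn hj hl m₁ m₂ p k,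
    M.B_le_Z _ _ _ _, Multicomplex.exists_spectralCohomology_equiv hj hl m₁ m₂ p k⟩, fun p k => ?_,
    fun k J L m₁ m₂ hJ hL _ _ hZ hB => ?_⟩
  · obtain ⟨J, hJ, hZJ, hJI⟩ := Multicomplex.exists_stable_index (fun r => M.Z r p k)
      (M.ZInf p k) (N := N + p.natAbs + 1) fun r hr => hN.Z_eq_ZInf (by omega) (by omega)
    obtain ⟨L, hL, hBL, hLI⟩ := Multicomplex.exists_stable_index (fun r => M.B r p k)
      (M.BInf p k) (N := N + p.natAbs + 1) fun r hr => hN.B_eq_BInf (by omega) (by omega)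
    refine ⟨J, L, hJ, hL, hZJ, hBL, hJI.imp (fun h => Multicomplex.mem_I_iff.2 ⟨hJ, h⟩) fun h => ?_,
      hLI.imp (fun h => Multicomplex.mem_I_sub_iff.2 ⟨hL, h⟩) fun h l hl => ?_⟩
    · refine Set.eq_empty_of_forall_notMem fun j hj => ?_
      obtain ⟨hj1, hj⟩ := Multicomplex.mem_I_iff.1 hj
      exact hj (h j hj1)
    · obtain ⟨hl1, hl⟩ := Multicomplex.mem_I_sub_iff.1 hl
      exact hl (h l hl1)
  · have he : ∀ p, ∃ e : M.SpectralCohomology (hJ p) (hL p) (m₁ p) (m₂ p) p k ≃ₗ[𝕜] M.EInf p k,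
        ∀ x : LinearMap.ker (M.deltaOut (hJ p) (L p) (m₂ p) p k),
          ∃ hx : ((x : M.E (J p) (L p) p k) : V) ∈ M.ZInf p k,
            e (Submodule.Quotient.mk x) =
              Submodule.Quotient.mk ⟨((x : M.E (J p) (L p) p k) : V), hx⟩ := fun p => by
      have h := Multicomplex.exists_spectralCohomology_equiv (M := M) (hJ p) (hL p) (m₁ p) (m₂ p)
        p k
      rw [hZ, hB] at h
      exact h
    choose e he using he
    obtain ⟨Φ, hΦ⟩ := hN.exists_directSum_EInf_equiv k
    refine ⟨DirectSum.congrLinearEquiv e, Φ, fun p x => ?_, hΦ⟩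
    obtain ⟨hx, hex⟩ := he p x
    refine ⟨hx, ?_⟩
    rw [← hex, DirectSum.coe_congrLinearEquiv, DirectSum.lmap_lof]
    rfl
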